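/- For each choice of the sign $\pm$, the Diophantine equation $x^3\pm y^3=a^6+b^6$ has infinitely many nontrivial solutions $(x,y,a,b)$ in positive integers. Here a solution is called nontrivial if $\gcd(x,y,a,b)=1$ and no partial sum of the expression $x^3\pm y^3-(a^6+b^6)$ vanishes, i.e. no sum over a nonempty proper subset of the four terms $x^3,\ \pm y^3,\ -a^6,\ -b^6$ is equal to $0$. -/

import Mathlib

/-- The four terms of the expression `x ^ 3 + ε * y ^ 3 - (a ^ k + δ * b ^ k)`;
`ε` and `δ` are the signs, each meant to be `1` or `-1`. -/
def diagTerms (k : ℕ) (ε δ x y a b : ℤ) : Fin 4 → ℤ :=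
  ![x ^ 3, ε * y ^ 3, -(a ^ k), -(δ * b ^ k)]

/-- `(x, y, a, b)` is a nontrivial solution of `x ^ 3 + ε * y ^ 3 = a ^ k + δ * b ^ k`:
the equation holds, the four integers have no common factor, and no partial sum
(sum over a nonempty proper subset of the four terms) vanishes. -/
def IsNontrivialSolution (k : ℕ) (ε δ x y a b : ℤ) : Prop :=
  x ^ 3 + ε * y ^ 3 = a ^ k + δ * b ^ k ∧
  Nat.gcd (Int.gcd x y) (Int.gcd a b) = 1 ∧
  ∀ S : Finset (Fin 4), S.Nonempty → S ≠ Finset.univ →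
    ∑ i ∈ S, diagTerms k ε δ x y a b i ≠ 0

/-!
The sextic `a ^ 6 + b ^ 6` factors as `G * F` with `G = a ^ 2 + b ^ 2` and
`F = a ^ 4 - a ^ 2 * b ^ 2 + b ^ 4`. Fix coprime `p`, `q` and look for solutions of
`X ^ 3 + Y ^ 3 = G * F` with `p * (X + Y) = q * G` and
`q * (X ^ 2 - X * Y + Y ^ 2) = p * F`. Writing `G = p * z`, `X + Y = q * z`, `X - Y = D` and
`3 * K = 4 * p ^ 3 - q ^ 3`, the two conditions become

  `a ^ 2 + b ^ 2 = p * z`,  `q * D ^ 2 = K * z ^ 2 - 4 * p * a ^ 2 * b ^ 2`  (`FibrePoint`),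

which for fixed `p`, `q` is a curve of genus one. Integral points of it with `a`, `b` coprime give
primitive solutions, so it suffices to find one such curve with infinitely many of them. The sign
of `Y` is governed by the size of `p / q` alone: `Y > 0` on the whole curve when `p < q`, and
`X * Y < 0` on the whole curve when `4 * q ^ 3 < p ^ 3`. This yields the two choices of sign.

Infinitely many points come from multiplication by five on the curve, which is given by explicit
polynomials (`quintA`, `quintB`, `quintSum`, `quintDiff`; the key identity is `quint_identity`).
Near `b = 0` it acts `5`-adically as multiplication by `5`, hence it raises the `5`-adic valuation
of `b` by exactly one as soon as this valuation is positive, and the orbit of a point with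
`5 ∣ b` is infinite. The multiplier five is prime to six on purpose: at a prime dividing `p` the
curve has bad reduction with component group of order six, and the condition `p ∣ a ^ 2 + b ^ 2`
singles out components which multiplication by three would not preserve. Concretely, the common
factor of the new `a` and `b` is prime to `p` (`FibrePoint.isCoprime_quint`), and therefore
integrality survives dividing it out (`FibrePoint.of_smul`).
-/

/-! ### The genus one fibres -/

/-- Conditions on the parameters `p`, `q`, `K` of a fibre. -/
structure FibreParams (p q K : ℤ) : Prop where
  p_pos : 0 < p
  q_pos : 0 < q
  p_odd : Odd p
  q_odd : Odd q
  p_sqfree : Squarefree p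
  q_sqfree : Squarefree q
  coprime : IsCoprime p q
  three_mul : 3 * K = 4 * p ^ 3 - q ^ 3
  five_p : ¬ (5 : ℤ) ∣ p
  five_K : ¬ (5 : ℤ) ∣ K

/-- A primitive integral point on the fibre with parameters `p`, `q`, `K`. It encodes the solution
`(q * z + D) / 2`, `(q * z - D) / 2`, `a`, `b` of `X ^ 3 + Y ^ 3 = a ^ 6 + b ^ 6`. -/
structure FibrePoint (p q K a b z D : ℤ) : Prop where
  coprime : IsCoprime a b
  sum_sq : a ^ 2 + b ^ 2 = p * z
  norm_eq : q * D ^ 2 = K * z ^ 2 - 4 * p * (a * b) ^ 2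

/-! ### Multiplication by five -/

/-- The part of the quintupling polynomials symmetric in `a ^ 2` and `b ^ 2`, as a polynomial in
`z = (a ^ 2 + b ^ 2) / p` and `n = a ^ 2 * b ^ 2`. -/
def quintSymm (p K z n : ℤ) : ℤ :=
    3 * z ^ 12 * p ^ 3 * K ^ 6 - 16 * z ^ 10 * n * p * K ^ 6 - 40 * z ^ 10 * n * p ^ 4 * K ^ 5
    + 272 * z ^ 8 * n ^ 2 * p ^ 2 * K ^ 5 + 128 * z ^ 8 * n ^ 2 * p ^ 5 * K ^ 4
    - 256 * z ^ 6 * n ^ 3 * K ^ 5 - 1024 * z ^ 6 * n ^ 3 * p ^ 3 * K ^ 4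
    + 1280 * z ^ 4 * n ^ 4 * p * K ^ 4 + 2048 * z ^ 2 * n ^ 5 * p ^ 2 * K ^ 3
    - 4096 * n ^ 6 * K ^ 3

/-- The cofactor of `z * (b ^ 2 - a ^ 2)` in the part of the quintupling polynomials antisymmetric
in `a ^ 2` and `b ^ 2`. -/
def quintAnti (p K z n : ℤ) : ℤ :=
    -2 * z ^ 10 * p ^ 3 * K ^ 6 + 40 * z ^ 8 * n * p ^ 4 * K ^ 5
    - 192 * z ^ 6 * n ^ 2 * p ^ 2 * K ^ 5 - 128 * z ^ 6 * n ^ 2 * p ^ 5 * K ^ 4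
    + 512 * z ^ 4 * n ^ 3 * K ^ 5 + 768 * z ^ 4 * n ^ 3 * p ^ 3 * K ^ 4
    - 2560 * z ^ 2 * n ^ 4 * p * K ^ 4 + 2048 * n ^ 5 * p ^ 2 * K ^ 3

/-- The factor by which quintupling multiplies `a`; a power of `p` common to `quintA` and `quintB`
has been removed. -/
def quintA (p K z a b : ℤ) : ℤ :=
  p * quintSymm p K z ((a * b) ^ 2) - (b ^ 2 - a ^ 2) * (z * quintAnti p K z ((a * b) ^ 2))

/-- The factor by which quintupling multiplies `b`. -/
def quintB (p K z a b : ℤ) : ℤ :=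
  p * quintSymm p K z ((a * b) ^ 2) + (b ^ 2 - a ^ 2) * (z * quintAnti p K z ((a * b) ^ 2))

/-- The factor by which quintupling multiplies `z`, with `(b ^ 2 - a ^ 2) ^ 2` expressed through
`z` and `n = a ^ 2 * b ^ 2`. -/
def quintSum (p K z n : ℤ) : ℤ :=
  p ^ 2 * quintSymm p K z n ^ 2
    + (p ^ 2 * z ^ 2 - 4 * n) * (z ^ 2 * quintAnti p K z n ^ 2)
    + 2 * (p ^ 2 * z ^ 2 - 4 * n) * quintSymm p K z n * quintAnti p K z n

/-- The factor by which quintupling multiplies `D`. -/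
def quintDiff (p K z n : ℤ) : ℤ :=
    z ^ 24 * p ^ 8 * K ^ 12 - 48 * z ^ 22 * n * p ^ 9 * K ^ 11
    + 800 * z ^ 20 * n ^ 2 * p ^ 7 * K ^ 11 + 256 * z ^ 20 * n ^ 2 * p ^ 10 * K ^ 10
    - 8960 * z ^ 18 * n ^ 3 * p ^ 5 * K ^ 11 - 5120 * z ^ 18 * n ^ 3 * p ^ 8 * K ^ 10
    + 40960 * z ^ 16 * n ^ 4 * p ^ 3 * K ^ 11 + 85760 * z ^ 16 * n ^ 4 * p ^ 6 * K ^ 10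
    - 65536 * z ^ 14 * n ^ 5 * p * K ^ 11 - 475136 * z ^ 14 * n ^ 5 * p ^ 4 * K ^ 10
    - 270336 * z ^ 14 * n ^ 5 * p ^ 7 * K ^ 9 + 851968 * z ^ 12 * n ^ 6 * p ^ 2 * K ^ 10
    + 2080768 * z ^ 12 * n ^ 6 * p ^ 5 * K ^ 9 + 851968 * z ^ 12 * n ^ 6 * p ^ 8 * K ^ 8
    - 4325376 * z ^ 10 * n ^ 7 * p ^ 3 * K ^ 9 - 7602176 * z ^ 10 * n ^ 7 * p ^ 6 * K ^ 8
    - 1048576 * z ^ 10 * n ^ 7 * p ^ 9 * K ^ 7 + 21954560 * z ^ 8 * n ^ 8 * p ^ 4 * K ^ 8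
    + 10485760 * z ^ 8 * n ^ 8 * p ^ 7 * K ^ 7 - 20971520 * z ^ 6 * n ^ 9 * p ^ 2 * K ^ 8
    - 36700160 * z ^ 6 * n ^ 9 * p ^ 5 * K ^ 7 + 16777216 * z ^ 4 * n ^ 10 * K ^ 8
    + 52428800 * z ^ 4 * n ^ 10 * p ^ 3 * K ^ 7 - 50331648 * z ^ 2 * n ^ 11 * p * K ^ 7
    + 16777216 * n ^ 12 * p ^ 2 * K ^ 6

/-- The polynomial identity expressing that quintupling maps the curve to itself. -/
theorem quint_identity (p K z n : ℤ) :
    K * (z * quintSum p K z n) ^ 2 - 4 * p * n * (p ^ 2 * quintSymm p K z n ^ 2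
        - (p ^ 2 * z ^ 2 - 4 * n) * (z ^ 2 * quintAnti p K z n ^ 2)) ^ 2
      = (K * z ^ 2 - 4 * p * n) * quintDiff p K z n ^ 2 := by
  simp only [quintSum, quintSymm, quintAnti, quintDiff]
  ring

theorem quint_sum_sq {p K z a b : ℤ} (h : a ^ 2 + b ^ 2 = p * z) :
    (a * quintA p K z a b) ^ 2 + (b * quintB p K z a b) ^ 2
      = p * (z * quintSum p K z ((a * b) ^ 2)) := by
  simp only [quintA, quintB, quintSum]
  generalize quintSymm p K z ((a * b) ^ 2) = s
  generalize quintAnti p K z ((a * b) ^ 2) = t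
  have hH : (b ^ 2 - a ^ 2) ^ 2 = p ^ 2 * z ^ 2 - 4 * (a * b) ^ 2 := by
    linear_combination (a ^ 2 + b ^ 2 + p * z) * h
  linear_combination (p ^ 2 * s ^ 2 + (b ^ 2 - a ^ 2) ^ 2 * z ^ 2 * t ^ 2) * h
    + (p * z ^ 3 * t ^ 2 + 2 * p * z * s * t) * hH

theorem quint_norm_eq {p q K z a b D : ℤ} (h : FibrePoint p q K a b z D) :
    q * (D * quintDiff p K z ((a * b) ^ 2)) ^ 2
      = K * (z * quintSum p K z ((a * b) ^ 2)) ^ 2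
        - 4 * p * (a * quintA p K z a b * (b * quintB p K z a b)) ^ 2 := by
  have hH : (b ^ 2 - a ^ 2) ^ 2 = p ^ 2 * z ^ 2 - 4 * (a * b) ^ 2 := by
    linear_combination (a ^ 2 + b ^ 2 + p * z) * h.sum_sq
  have hAB : quintA p K z a b * quintB p K z a b
      = p ^ 2 * quintSymm p K z ((a * b) ^ 2) ^ 2
        - (p ^ 2 * z ^ 2 - 4 * (a * b) ^ 2) * (z ^ 2 * quintAnti p K z ((a * b) ^ 2) ^ 2) := by
    rw [← hH, quintA, quintB]
    ring
  have e : (a * quintA p K z a b * (b * quintB p K z a b)) ^ 2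
      = (a * b) ^ 2 * (quintA p K z a b * quintB p K z a b) ^ 2 := by ring
  rw [e, hAB]
  linear_combination quintDiff p K z ((a * b) ^ 2) ^ 2 * h.norm_eq
    - quint_identity p K z ((a * b) ^ 2)

/-! ### Primes dividing `p` -/

/-- A prime dividing `p` is odd and divides none of `K`, `a`, `b`, `z`. For `z` this uses that `p`
is squarefree: otherwise the prime would divide `D`, and its square would divide
`4 * p * (a * b) ^ 2`. -/
theorem FibrePoint.not_dvd_of_prime {p q K a b z D r : ℤ} (hP : FibreParams p q K)
    (h : FibrePoint p q K a b z D) (hr : Prime r) (hrp : r ∣ p) :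
    ¬ r ∣ 2 ∧ ¬ r ∣ K ∧ ¬ r ∣ a ∧ ¬ r ∣ b ∧ ¬ r ∣ z := by
  have hcop : ∀ {m n : ℤ}, IsCoprime m n → r ∣ m → r ∣ n → False := fun hmn hm hn =>
    hr.not_isUnit (hmn.isUnit_of_dvd' hm hn)
  have hsum : r ∣ a ^ 2 + b ^ 2 := h.sum_sq ▸ hrp.mul_right z
  have h2 : ¬ r ∣ 2 := fun h2 => by
    obtain ⟨m, hm⟩ := hP.p_odd
    have : r ∣ 1 := by
      have := dvd_sub hrp (h2.mul_right m)
      rwa [hm, add_sub_cancel_left] at this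
    exact hr.not_dvd_one this
  have hq : ¬ r ∣ q := hcop hP.coprime hrp
  have ha : ¬ r ∣ a := fun ha => hcop h.coprime ha <|
    hr.dvd_of_dvd_pow ((dvd_add_right (dvd_pow ha two_ne_zero)).1 hsum)
  have hb : ¬ r ∣ b := fun hb => hcop h.coprime
    (hr.dvd_of_dvd_pow ((dvd_add_left (dvd_pow hb two_ne_zero)).1 hsum)) hb
  have hK : ¬ r ∣ K := fun hK => hq <| hr.dvd_of_dvd_pow (n := 3) <| by
    have e : q ^ 3 = 4 * p ^ 3 - 3 * K := by linear_combination hP.three_mul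
    rw [e]
    exact dvd_sub ((dvd_pow hrp three_ne_zero).mul_left 4) (hK.mul_left 3)
  refine ⟨h2, hK, ha, hb, fun hz => ?_⟩
  have hD : r ∣ D := by
    have : r ∣ q * D ^ 2 := by
      rw [h.norm_eq]
      exact dvd_sub ((dvd_pow hz two_ne_zero).mul_left K) (((hrp.mul_left 4)).mul_right _)
    exact hr.dvd_of_dvd_pow ((hr.dvd_or_dvd this).resolve_left hq)
  obtain ⟨z', rfl⟩ := hz
  obtain ⟨D', rfl⟩ := hD
  obtain ⟨p', rfl⟩ := hrp
  have e : r * (r * (K * z' ^ 2 - q * D' ^ 2)) = r * (2 * 2 * p' * (a * b) ^ 2) := by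
    linear_combination -h.norm_eq
  have hdvd : r ∣ 2 * 2 * p' * (a * b) ^ 2 := ⟨_, (mul_left_cancel₀ hr.ne_zero e).symm⟩
  have hp' : r ∣ p' := by
    rcases hr.dvd_or_dvd hdvd with h1 | h1
    · rcases hr.dvd_or_dvd h1 with h1 | h1
      · rcases hr.dvd_or_dvd h1 with h1 | h1 <;> exact absurd h1 h2
      · exact h1
    · rcases hr.dvd_or_dvd (hr.dvd_of_dvd_pow h1) with h1 | h1
      · exact absurd h1 ha
      · exact absurd h1 hb
  exact hr.not_isUnit (hP.p_sqfree r (mul_dvd_mul_left r hp'))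

/-- The common factor of the coordinates produced by quintupling is prime to `p`. The reason is
that modulo `p` the polynomial `quintA` reduces to a single monomial times `b ^ 2 - a ^ 2`. -/
theorem FibrePoint.isCoprime_quint {p q K a b z D g : ℤ} (hP : FibreParams p q K)
    (h : FibrePoint p q K a b z D) (hg : g ∣ a * quintA p K z a b) : IsCoprime g p := by
  refine isCoprime_of_prime_dvd (fun h0 => hP.p_pos.ne' h0.2) fun r hr hrg hrp => ?_
  obtain ⟨h2, hK, ha, hb, hz⟩ := h.not_dvd_of_prime hP hr hrp
  have hA : r ∣ quintA p K z a b := (hr.dvd_or_dvd (hrg.trans hg)).resolve_left ha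
  have hsum : r ∣ a ^ 2 + b ^ 2 := h.sum_sq ▸ hrp.mul_right z
  -- modulo `a ^ 2 + b ^ 2`, the difference `b ^ 2 - a ^ 2` is `2 * b ^ 2`
  have hmono : r ∣ 2 ^ 10 * (b ^ 2 * (z ^ 5 * (((a * b) ^ 2) ^ 3 * K ^ 5))) := by
    obtain ⟨c, hc⟩ : p ∣ quintA p K z a b
        + (b ^ 2 - a ^ 2) * (512 * z ^ 5 * ((a * b) ^ 2) ^ 3 * K ^ 5) := by
      refine ⟨quintSymm p K z ((a * b) ^ 2) - (b ^ 2 - a ^ 2) * z * (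
        -2 * z ^ 10 * p ^ 2 * K ^ 6 + 40 * z ^ 8 * (a * b) ^ 2 * p ^ 3 * K ^ 5
        - 192 * z ^ 6 * ((a * b) ^ 2) ^ 2 * p * K ^ 5
        - 128 * z ^ 6 * ((a * b) ^ 2) ^ 2 * p ^ 4 * K ^ 4
        + 768 * z ^ 4 * ((a * b) ^ 2) ^ 3 * p ^ 2 * K ^ 4 - 2560 * z ^ 2 * ((a * b) ^ 2) ^ 4 * K ^ 4
        + 2048 * ((a * b) ^ 2) ^ 5 * p * K ^ 3), ?_⟩
      simp only [quintA, quintAnti]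
      ring
    have e : 2 ^ 10 * (b ^ 2 * (z ^ 5 * (((a * b) ^ 2) ^ 3 * K ^ 5)))
        = p * c - quintA p K z a b
          + (a ^ 2 + b ^ 2) * (512 * z ^ 5 * ((a * b) ^ 2) ^ 3 * K ^ 5) := by
      linear_combination hc
    rw [e]
    exact dvd_add (dvd_sub (hrp.mul_right c) hA) (hsum.mul_right _)
  have hab : ¬ r ∣ a * b := fun hab => (hr.dvd_or_dvd hab).elim ha hb
  rcases hr.dvd_or_dvd hmono with h1 | h1
  · exact h2 (hr.dvd_of_dvd_pow h1)
  rcases hr.dvd_or_dvd h1 with h1 | h1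
  · exact hb (hr.dvd_of_dvd_pow h1)
  rcases hr.dvd_or_dvd h1 with h1 | h1
  · exact hz (hr.dvd_of_dvd_pow h1)
  rcases hr.dvd_or_dvd h1 with h1 | h1
  · exact hab (hr.dvd_of_dvd_pow (hr.dvd_of_dvd_pow h1))
  · exact hK (hr.dvd_of_dvd_pow h1)

/-! ### Passing to coprime coordinates -/

/-- An integral point whose coordinates `a`, `b` have a common factor `g` prime to `p` yields an
integral point with that factor divided out. -/
theorem FibrePoint.of_smul {p q K a b g Z D : ℤ} (hq : Squarefree q) (hq0 : q ≠ 0) (hg0 : g ≠ 0)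
    (hg : IsCoprime g p) (hab : IsCoprime a b) (hsum : (g * a) ^ 2 + (g * b) ^ 2 = p * Z)
    (hnorm : q * D ^ 2 = K * Z ^ 2 - 4 * p * (g * a * (g * b)) ^ 2) :
    ∃ z D', FibrePoint p q K a b z D' := by
  have hg2 : g ^ 2 ≠ 0 := pow_ne_zero 2 hg0
  obtain ⟨z, rfl⟩ : g ^ 2 ∣ Z := (hg.pow_left (m := 2)).dvd_of_dvd_mul_left
    ⟨a ^ 2 + b ^ 2, by linear_combination -hsum⟩
  -- `D / g ^ 2` is a rational number whose square times the squarefree `q` is an integer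
  have hj2 : (q * D) ^ 2 = (g ^ 2) ^ 2 * (q * (K * z ^ 2 - 4 * p * (a * b) ^ 2)) := by
    linear_combination q * hnorm
  obtain ⟨j, hj⟩ : g ^ 2 ∣ q * D := (Int.pow_dvd_pow_iff two_ne_zero).1 ⟨_, hj2⟩
  have hjq : j ^ 2 = q * (K * z ^ 2 - 4 * p * (a * b) ^ 2) := by
    rw [hj, mul_pow] at hj2
    exact mul_left_cancel₀ (pow_ne_zero 2 hg2) hj2
  obtain ⟨D', rfl⟩ : q ∣ j := (hq.dvd_pow_iff_dvd two_ne_zero).1 ⟨_, hjq⟩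
  refine ⟨z, D', hab, mul_left_cancel₀ hg2 ?_, mul_left_cancel₀ hq0 ?_⟩
  · linear_combination hsum
  · linear_combination hjq

/-! ### The orbit of a point -/

/-- Quintupling raises the `5`-adic valuation of `b` by one. -/
theorem FibrePoint.exists_quint {p q K a b z D : ℤ} {k : ℕ} (hP : FibreParams p q K)
    (h : FibrePoint p q K a b z D) (hk : k ≠ 0) (hb : 5 ^ k ∣ b) (hb' : ¬ 5 ^ (k + 1) ∣ b) :
    ∃ a' b' z' D', FibrePoint p q K a' b' z' D' ∧ 5 ^ (k + 1) ∣ b' ∧ ¬ 5 ^ (k + 1 + 1) ∣ b' := by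
  have h5 : Prime (5 : ℤ) := by norm_num
  have hb5 : 5 ∣ b := (dvd_pow_self 5 hk).trans hb
  have ha5 : ¬ 5 ∣ a := fun ha => h5.not_isUnit (h.coprime.isUnit_of_dvd' ha hb5)
  have hz5 : ¬ 5 ∣ z := fun hz => ha5 <| h5.dvd_of_dvd_pow <|
    (dvd_add_left (dvd_pow hb5 two_ne_zero)).1 (h.sum_sq ▸ hz.mul_left p)
  have hu5 : ¬ 5 ∣ z ^ 12 * (p ^ 4 * K ^ 6) := fun hu => by
    rcases h5.dvd_or_dvd hu with h1 | h1
    · exact hz5 (h5.dvd_of_dvd_pow h1)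
    rcases h5.dvd_or_dvd h1 with h1 | h1
    · exact hP.five_p (h5.dvd_of_dvd_pow h1)
    · exact hP.five_K (h5.dvd_of_dvd_pow h1)
  -- modulo `25` one may set `b = 0`, which also gives `b ^ 2 - a ^ 2 = -(p * z)`
  have hb25 : (b ^ 2 : ℤ) ≡ 0 [ZMOD 25] :=
    Int.modEq_zero_iff_dvd.2 (by simpa using pow_dvd_pow_of_dvd hb5 2)
  have hn : ((a * b) ^ 2 : ℤ) ≡ 0 [ZMOD 25] := by
    rw [mul_pow]
    simpa using hb25.mul_left (a ^ 2)
  have hH : b ^ 2 - a ^ 2 ≡ -(p * z) [ZMOD 25] := by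
    have e : b ^ 2 - a ^ 2 = 2 * b ^ 2 - p * z := by linear_combination -h.sum_sq
    rw [e]
    simpa using (hb25.mul_left 2).sub_right (p * z)
  have hS : quintSymm p K z ((a * b) ^ 2) ≡ 3 * z ^ 12 * p ^ 3 * K ^ 6 [ZMOD 25] := by
    have : quintSymm p K z ((a * b) ^ 2) ≡ quintSymm p K z 0 [ZMOD 25] := by
      unfold quintSymm
      gcongr
    simpa [quintSymm] using this
  have hT : quintAnti p K z ((a * b) ^ 2) ≡ -2 * z ^ 10 * p ^ 3 * K ^ 6 [ZMOD 25] := by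
    have : quintAnti p K z ((a * b) ^ 2) ≡ quintAnti p K z 0 [ZMOD 25] := by
      unfold quintAnti
      gcongr
    simpa [quintAnti] using this
  have hA : quintA p K z a b ≡ z ^ 12 * (p ^ 4 * K ^ 6) [ZMOD 25] := by
    have e : p * (3 * z ^ 12 * p ^ 3 * K ^ 6) - -(p * z) * (z * (-2 * z ^ 10 * p ^ 3 * K ^ 6))
        = z ^ 12 * (p ^ 4 * K ^ 6) := by ring
    exact e ▸ (hS.mul_left p).sub (hH.mul (hT.mul_left z))
  have hB : quintB p K z a b ≡ 5 * (z ^ 12 * (p ^ 4 * K ^ 6)) [ZMOD 25] := by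
    have e : p * (3 * z ^ 12 * p ^ 3 * K ^ 6) + -(p * z) * (z * (-2 * z ^ 10 * p ^ 3 * K ^ 6))
        = 5 * (z ^ 12 * (p ^ 4 * K ^ 6)) := by ring
    exact e ▸ (hS.mul_left p).add (hH.mul (hT.mul_left z))
  have hA5 : ¬ 5 ∣ a * quintA p K z a b := fun hdvd => by
    rcases h5.dvd_or_dvd hdvd with h1 | h1
    · exact ha5 h1
    · exact hu5 (((hA.of_dvd (by norm_num : (5 : ℤ) ∣ 25)).dvd_iff).1 h1)
  obtain ⟨β, hβ⟩ : 5 ∣ quintB p K z a b :=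
    ((hB.of_dvd (by norm_num : (5 : ℤ) ∣ 25)).dvd_iff).2 (dvd_mul_right _ _)
  have hβ5 : ¬ 5 ∣ β := fun hdvd => hu5 <| by
    have h25 : (25 : ℤ) ∣ quintB p K z a b := by
      rw [hβ]
      exact mul_dvd_mul_left 5 hdvd
    have := (hB.dvd_iff).1 h25
    exact Int.dvd_of_mul_dvd_mul_left (by norm_num : (5 : ℤ) ≠ 0) this
  obtain ⟨c, rfl⟩ := hb
  have hc5 : ¬ 5 ∣ c := fun hdvd => hb' (by rw [pow_succ]; exact mul_dvd_mul_left _ hdvd)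
  have hA0 : a * quintA p K z a (5 ^ k * c) ≠ 0 := fun h0 => hA5 (h0 ▸ dvd_zero 5)
  obtain ⟨g, a', b', hg0, hcop, hga, hgb⟩ :
      ∃ g a' b' : ℤ, g ≠ 0 ∧ IsCoprime a' b' ∧ a * quintA p K z a (5 ^ k * c) = g * a' ∧
        5 ^ k * c * quintB p K z a (5 ^ k * c) = g * b' := by
    have hne : Int.gcd (a * quintA p K z a (5 ^ k * c))
        (5 ^ k * c * quintB p K z a (5 ^ k * c)) ≠ 0 := fun h0 => hA0 (Int.gcd_eq_zero_iff.1 h0).1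
    obtain ⟨a', b', hcop, h1, h2⟩ := Int.exists_gcd_one (Nat.pos_of_ne_zero hne)
    exact ⟨_, a', b', Int.natCast_ne_zero.2 hne, Int.isCoprime_iff_gcd_eq_one.2 hcop,
      h1.trans (mul_comm _ _), h2.trans (mul_comm _ _)⟩
  have hg5 : ¬ 5 ∣ g := fun hdvd => hA5 (hga ▸ hdvd.mul_right a')
  have hgp : IsCoprime g p := h.isCoprime_quint hP ⟨a', hga⟩
  have hsum := quint_sum_sq (K := K) h.sum_sq
  have hnorm := quint_norm_eq h
  rw [hga, hgb] at hsum hnorm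
  obtain ⟨z', D', h'⟩ := FibrePoint.of_smul hP.q_sqfree hP.q_pos.ne' hg0 hgp hcop hsum hnorm
  have hgb' : g * b' = 5 ^ (k + 1) * (c * β) := by
    rw [← hgb, hβ]
    ring
  refine ⟨a', b', z', D', h', ?_, fun hdvd => ?_⟩
  · exact h5.pow_dvd_of_dvd_mul_left _ hg5 ⟨_, hgb'⟩
  · have h1 : (5 : ℤ) ^ (k + 1) * 5 ∣ 5 ^ (k + 1) * (c * β) := by
      rw [← hgb', ← pow_succ]
      exact hdvd.mul_left g
    have h2 := Int.dvd_of_mul_dvd_mul_left (by positivity : (5 : ℤ) ^ (k + 1) ≠ 0) h1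
    exact (h5.dvd_or_dvd h2).elim hc5 hβ5

theorem FibrePoint.exists_pow_dvd {p q K a b z D : ℤ} (hP : FibreParams p q K)
    (h : FibrePoint p q K a b z D) (hb : 5 ∣ b) (hb' : ¬ 25 ∣ b) (k : ℕ) :
    ∃ a' b' z' D', FibrePoint p q K a' b' z' D' ∧ 5 ^ (k + 1) ∣ b' ∧
      ¬ 5 ^ (k + 1 + 1) ∣ b' := by
  induction k with
  | zero => exact ⟨a, b, z, D, h, by simpa using hb, by simpa using hb'⟩
  | succ k ih =>
    obtain ⟨a', b', z', D', h', h1, h2⟩ := ih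
    exact h'.exists_quint hP k.succ_ne_zero h1 h2

/-! ### From fibre points to solutions -/

/-- A solution in which `x ^ 3` is neither `a ^ 6` nor `b ^ 6` has no vanishing partial sum,
provided the four integers are nonzero. -/
theorem isNontrivialSolution_of_ne {ε x y a b : ℤ} (hε : ε = 1 ∨ ε = -1) (hx : x ≠ 0) (hy : y ≠ 0)
    (ha : a ≠ 0) (hb : b ≠ 0) (heq : x ^ 3 + ε * y ^ 3 = a ^ 6 + b ^ 6) (hab : IsCoprime a b)
    (hxa : x ^ 3 ≠ a ^ 6) (hxb : x ^ 3 ≠ b ^ 6) : IsNontrivialSolution 6 ε 1 x y a b := by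
  refine ⟨by linear_combination heq, ?_, ?_⟩
  · rw [Int.isCoprime_iff_gcd_eq_one.1 hab, Nat.gcd_one_right]
  · have hx3 : x ^ 3 ≠ 0 := pow_ne_zero 3 hx
    have hy3 : ε * y ^ 3 ≠ 0 := mul_ne_zero (by rcases hε with rfl | rfl <;> norm_num)
      (pow_ne_zero 3 hy)
    have ha6 : 0 < a ^ 6 := by positivity
    have hb6 : 0 < b ^ 6 := by positivity
    simp only [diagTerms]
    generalize x ^ 3 = s at *
    generalize ε * y ^ 3 = t at *
    generalize a ^ 6 = u at *
    generalize b ^ 6 = v at *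
    intro S hS hS' h0
    have hsome : (0 : Fin 4) ∈ S ∨ (1 : Fin 4) ∈ S ∨ (2 : Fin 4) ∈ S ∨ (3 : Fin 4) ∈ S := by
      obtain ⟨i, hi⟩ := hS
      fin_cases i <;> simp_all
    have hnot : ¬ ((0 : Fin 4) ∈ S ∧ (1 : Fin 4) ∈ S ∧ (2 : Fin 4) ∈ S ∧ (3 : Fin 4) ∈ S) :=
      fun hall => hS' <| by
        ext i
        fin_cases i <;> simp [hall]
    rw [← Finset.univ_inter S, ← Finset.sum_ite_mem, Fin.sum_univ_four] at h0
    by_cases h00 : (0 : Fin 4) ∈ S <;> by_cases h01 : (1 : Fin 4) ∈ S <;>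
      by_cases h02 : (2 : Fin 4) ∈ S <;> by_cases h03 : (3 : Fin 4) ∈ S <;>
      simp [h00, h01, h02, h03] at h0 hsome hnot <;> omega

/-- The roots `(q * z + |D|) / 2` and `(q * z - |D|) / 2` attached to a fibre point form a
nontrivial solution as soon as the second one has the sign `ε`. -/
theorem FibrePoint.exists_solution {p q K a b z D : ℤ} {ε : ℤ} (hε : ε = 1 ∨ ε = -1)
    (hP : FibreParams p q K) (hpq : p ≠ q) (h : FibrePoint p q K a b z D) (ha : a ≠ 0)
    (hb : b ≠ 0) (hy : ε * |D| < ε * (q * z)) :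
    ∃ x y : ℤ, 0 < x ∧ 0 < y ∧ IsNontrivialSolution 6 ε 1 x y |a| |b| := by
  have ha2 : 0 < a ^ 2 := by positivity
  have hb2 : 0 < b ^ 2 := by positivity
  have hz : 0 < z := pos_of_mul_pos_right (h.sum_sq ▸ add_pos ha2 hb2) hP.p_pos.le
  have hqz : 0 < q * z := mul_pos hP.q_pos hz
  have hpar : Even (q * z + |D|) := by
    obtain ⟨m, hm⟩ := hP.q_odd
    have hKodd : Odd K := by
      have h3 : Odd (3 * K) := by
        rw [hP.three_mul]
        exact Even.sub_odd (⟨2 * p ^ 3, by ring⟩) (hP.q_odd.pow)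
      exact (Int.odd_mul.1 h3).2
    have e : Even (q * D ^ 2 - K * z ^ 2) := ⟨-(2 * p * (a * b) ^ 2), by
      linear_combination h.norm_eq⟩
    have hq := hP.q_odd
    rw [Int.even_add, even_abs, Int.even_mul]
    rw [Int.even_sub, Int.even_mul, Int.even_mul, Int.even_pow' two_ne_zero,
      Int.even_pow' two_ne_zero] at e
    rw [← Int.not_even_iff_odd] at hq hKodd
    tauto
  obtain ⟨x, hx⟩ := hpar
  -- `y` is `ε` times the second root `q * z - x`
  have hεε : ε * ε = 1 := by rcases hε with rfl | rfl <;> norm_num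
  have hDx : |D| = 2 * x - q * z := by linear_combination hx
  have hD2 : D ^ 2 = (2 * x - q * z) ^ 2 := by rw [← hDx, sq_abs]
  have hy0 : 0 < ε * (q * z - x) := by
    rw [hDx] at hy
    linarith
  have hx0 : 0 < x := by
    have := abs_nonneg D
    linarith
  have hy3 : ε * (ε * (q * z - x)) ^ 3 = (q * z - x) ^ 3 := by
    linear_combination (ε * ε + 1) * (q * z - x) ^ 3 * hεε
  have hnorm := h.norm_eq
  rw [hD2] at hnorm
  have heq : x ^ 3 + ε * (ε * (q * z - x)) ^ 3 = a ^ 6 + b ^ 6 := by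
    rw [hy3]
    have key : 4 * (x ^ 3 + (q * z - x) ^ 3) = 4 * (a ^ 6 + b ^ 6) := by
      linear_combination 3 * z * hnorm + z ^ 3 * hP.three_mul
        - 4 * ((a ^ 2 + b ^ 2) ^ 2 + (a ^ 2 + b ^ 2) * (p * z) + (p * z) ^ 2
          - 3 * (a * b) ^ 2) * h.sum_sq
    exact mul_left_cancel₀ four_ne_zero key
  have hsix : ∀ c : ℤ, |c| ^ 6 = c ^ 6 := fun c => Even.pow_abs (by decide) c
  -- `x = a ^ 2` would force the second root to be `b ^ 2`, hence `q * z = p * z`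
  have hcube : ∀ c d : ℤ, c ^ 2 + d ^ 2 = p * z →
      x ^ 3 + ε * (ε * (q * z - x)) ^ 3 = c ^ 6 + d ^ 6 → x ^ 3 ≠ c ^ 6 := by
    intro c d hcd hs hxc
    have hinj := (Odd.strictMono_pow (R := ℤ) (by decide : Odd 3)).injective
    have hxc' : x = c ^ 2 := hinj (by linear_combination hxc)
    have hyd : q * z - x = d ^ 2 := hinj (by linear_combination hs - hxc - hy3)
    exact hpq (mul_right_cancel₀ hz.ne' (by linear_combination -hxc' - hyd - hcd))
  refine ⟨x, ε * (q * z - x), hx0, hy0, ?_⟩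
  refine isNontrivialSolution_of_ne hε hx0.ne' hy0.ne' (abs_ne_zero.2 ha) (abs_ne_zero.2 hb) ?_
    (IsCoprime.abs_abs h.coprime) ?_ ?_
  · rw [hsix, hsix, heq]
  · rw [hsix]
    exact hcube a b h.sum_sq heq
  · rw [hsix]
    exact hcube b a (by rw [add_comm, h.sum_sq]) (by rw [heq, add_comm])

/-- On a fibre where the second root has the sign `ε` everywhere, one point with `5 ∣ b` and
`25 ∤ b` yields infinitely many solutions: the values of `b` along its orbit are unbounded. -/
theorem FibrePoint.infinite_solutions {p q K a b z D : ℤ} {ε : ℤ} (hε : ε = 1 ∨ ε = -1)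
    (hP : FibreParams p q K) (hpq : p ≠ q) (h : FibrePoint p q K a b z D) (hb : 5 ∣ b)
    (hb' : ¬ 25 ∣ b)
    (hsign : ∀ a b z D : ℤ, 0 < z → FibrePoint p q K a b z D → ε * |D| < ε * (q * z)) :
    {q : ℤ × ℤ × ℤ × ℤ | 0 < q.1 ∧ 0 < q.2.1 ∧ 0 < q.2.2.1 ∧ 0 < q.2.2.2 ∧
      IsNontrivialSolution 6 ε 1 q.1 q.2.1 q.2.2.1 q.2.2.2}.Infinite := by
  refine Set.Infinite.of_image (fun q => q.2.2.2) (Set.infinite_of_forall_exists_gt fun m => ?_)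
  obtain ⟨a', b', z', D', h', h1, h2⟩ := h.exists_pow_dvd hP hb hb' m.toNat
  have hb0 : b' ≠ 0 := fun h0 => h2 (h0 ▸ dvd_zero _)
  have ha0 : a' ≠ 0 := fun h0 => by
    have hu : IsUnit b' := isCoprime_zero_left.1 (h0 ▸ h'.coprime)
    have h5 : (5 : ℤ) ∣ b' := (dvd_pow_self 5 (Nat.succ_ne_zero _)).trans h1
    exact (by norm_num : Prime (5 : ℤ)).not_isUnit (isUnit_of_dvd_unit h5 hu)
  have hz : 0 < z' := pos_of_mul_pos_right (h'.sum_sq ▸ (by positivity)) hP.p_pos.le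
  obtain ⟨x, y, hx, hy, hxy⟩ := h'.exists_solution hε hP hpq ha0 hb0 (hsign _ _ _ _ hz h')
  refine ⟨|b'|, ⟨(x, y, |a'|, |b'|), ⟨hx, hy, abs_pos.2 ha0, abs_pos.2 hb0, hxy⟩, rfl⟩, ?_⟩
  have hle : (5 : ℤ) ^ (m.toNat + 1) ≤ |b'| :=
    Int.le_of_dvd (abs_pos.2 hb0) ((dvd_abs _ _).2 h1)
  have hlt : ((m.toNat + 1 : ℕ) : ℤ) < 5 ^ (m.toNat + 1) := by
    exact_mod_cast Nat.lt_pow_self (by norm_num : 1 < 5)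
  have := Int.self_le_toNat m
  push_cast at hlt
  linarith

theorem FibrePoint.abs_lt {p q K a b z D : ℤ} (hP : FibreParams p q K) (hpq : p < q)
    (hz : 0 < z) (h : FibrePoint p q K a b z D) : |D| < q * z := by
  have hcube : p ^ 3 < q ^ 3 := pow_lt_pow_left₀ hpq hP.p_pos.le three_ne_zero
  have h1 : 0 < (q ^ 3 - p ^ 3) * z ^ 2 := mul_pos (sub_pos.2 hcube) (pow_pos hz 2)
  have h2 : 0 ≤ p * (a * b) ^ 2 := mul_nonneg hP.p_pos.le (sq_nonneg _)
  have h3 : 3 * (q * ((q * z) ^ 2 - D ^ 2))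
      = 4 * ((q ^ 3 - p ^ 3) * z ^ 2) + 12 * (p * (a * b) ^ 2) := by
    linear_combination -3 * h.norm_eq - z ^ 2 * hP.three_mul
  have h4 : 0 < (q * z) ^ 2 - D ^ 2 := pos_of_mul_pos_right (by linarith) hP.q_pos.le
  exact abs_lt_of_sq_lt_sq (sub_pos.1 h4) (mul_pos hP.q_pos hz).le

/-- The size condition comes from `(2 * a * b) ^ 2 ≤ (a ^ 2 + b ^ 2) ^ 2`. -/
theorem FibrePoint.lt_abs {p q K a b z D : ℤ} (hP : FibreParams p q K)
    (hpq : 4 * q ^ 3 < p ^ 3) (hz : 0 < z) (h : FibrePoint p q K a b z D) : q * z < |D| := by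
  have h1 : 0 < (p ^ 3 - 4 * q ^ 3) * z ^ 2 := mul_pos (sub_pos.2 hpq) (pow_pos hz 2)
  have h2 : 0 ≤ p * (b ^ 2 - a ^ 2) ^ 2 := mul_nonneg hP.p_pos.le (sq_nonneg _)
  have h3 : 3 * (q * (D ^ 2 - (q * z) ^ 2))
      = (p ^ 3 - 4 * q ^ 3) * z ^ 2 + 3 * (p * (b ^ 2 - a ^ 2) ^ 2) := by
    linear_combination 3 * h.norm_eq + z ^ 2 * hP.three_mul
      - 3 * p * (a ^ 2 + b ^ 2 + p * z) * h.sum_sq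
  have h4 : 0 < D ^ 2 - (q * z) ^ 2 := pos_of_mul_pos_right (by linarith) hP.q_pos.le
  exact (le_abs_self _).trans_lt (sq_lt_sq.1 (sub_pos.1 h4))

theorem mainTheorem2 (ε : ℤ) (hε : ε = 1 ∨ ε = -1) :
    {q : ℤ × ℤ × ℤ × ℤ | 0 < q.1 ∧ 0 < q.2.1 ∧ 0 < q.2.2.1 ∧ 0 < q.2.2.2 ∧
      IsNontrivialSolution 6 ε 1 q.1 q.2.1 q.2.2.1 q.2.2.2}.Infinite := by
  rcases hε with rfl | rfl
  · -- the point comes from `28596 ^ 3 + 28105 ^ 3 = 189 ^ 6 + 40 ^ 6`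
    have hP : FibreParams 37321 56701 8545787556181 :=
      ⟨by norm_num, by norm_num, by decide, by decide,
        (by norm_num : Prime (37321 : ℤ)).squarefree, (by norm_num : Prime (56701 : ℤ)).squarefree,
        by rw [Int.isCoprime_iff_gcd_eq_one]; norm_num, by norm_num, by norm_num, by norm_num⟩
    have h : FibrePoint 37321 56701 8545787556181 189 40 1 491 :=
      ⟨by rw [Int.isCoprime_iff_gcd_eq_one]; norm_num, by norm_num, by norm_num⟩
    refine h.infinite_solutions (.inl rfl) hP (by norm_num) (by norm_num) (by norm_num) ?_
    intro a b z D hz h'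
    simpa using h'.abs_lt hP (by norm_num) hz
  · -- the point comes from `5040 ^ 3 - 4031 ^ 3 = 63 ^ 6 + 10 ^ 6`
    have hP : FibreParams 4069 1009 89483532769 :=
      ⟨by norm_num, by norm_num, by decide, by decide, ?_,
        (by norm_num : Prime (1009 : ℤ)).squarefree,
        by rw [Int.isCoprime_iff_gcd_eq_one]; norm_num, by norm_num, by norm_num, by norm_num⟩
    · have h : FibrePoint 4069 1009 89483532769 63 10 1 9071 :=
        ⟨by rw [Int.isCoprime_iff_gcd_eq_one]; norm_num, by norm_num, by norm_num⟩
      refine h.infinite_solutions (.inr rfl) hP (by norm_num) (by norm_num) (by norm_num) ?_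
      intro a b z D hz h'
      simpa using h'.lt_abs hP (by norm_num) hz
    · rw [← Int.squarefree_natAbs]
      exact (Nat.squarefree_mul (m := 13) (n := 313) (by norm_num)).2
        ⟨(by norm_num : Nat.Prime 13).squarefree, (by norm_num : Nat.Prime 313).squarefree⟩
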